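/- Let $n, s, g$ be natural numbers with $n, g \ge 2$ and $s \ge 1$. A hypergraph is $n$-uniform if each of its edges is a set of exactly $n$ vertices. A cycle of length $m \ge 2$ in a hypergraph is a sequence $v_0 e_0 v_1 e_1 \cdots v_{m-1} e_{m-1}$ of distinct vertices $v_i$ and distinct edges $e_i$ with $\{v_i, v_{i+1}\} \subseteq e_i$ for all $i$ (indices modulo $m$), and the girth of a hypergraph is the least length of a cycle in it ($\infty$ if there is no cycle). Then there exists a finite $n$-uniform hypergraph $H$ of girth $\ge g$, with a partition $V_0 \sqcup \cdots \sqcup V_{n-1}$ of its vertex set, such that for any $s$ vertex-colourings $\chi_r : V(H) \to \omega$ ($r < s$), at least one of the following holds: (i) there exist $r < s$ and $i < n$ such that $\chi_r$ is constant (monochromatic) on some edge contained in $V_i$; (ii) there exists an edge $e$ which is a transversal (that is, $|e \cap V_i| = 1$ for all $i < n$) such that, for every $r < s$, $e$ is heterochromatic in $\chi_r$ (that is, distinct vertices of $e$ have distinct colours under $\chi_r$). -/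

import Mathlib

namespace Hypergraph

/-- Every edge of `H` has exactly `n` vertices. (For `n ≥ 1`, `ncard e = n` forces `e` finite.) -/
def IsUniform {α : Type*} (H : Hypergraph α) (n : ℕ) : Prop :=
  ∀ e ∈ H.edgeSet, e.ncard = n

/-- A cycle of length `m ≥ 2` in `H` (in the sense of Berge): a cyclic sequence
`v 0, e 0, v 1, e 1, …, v (m - 1), e (m - 1)` of distinct vertices `v i` and distinct edges `e i`
such that `e i` contains `v i` and `v (i + 1)`, where indices are taken modulo `m`. -/
structure IsCycle {α : Type*} (H : Hypergraph α) (m : ℕ) (v : ZMod m → α)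
    (e : ZMod m → Set α) : Prop where
  two_le : 2 ≤ m
  vertex_injective : Function.Injective v
  edge_injective : Function.Injective e
  edge_mem : ∀ i, e i ∈ H.edgeSet
  left_mem : ∀ i, v i ∈ e i
  right_mem : ∀ i, v (i + 1) ∈ e i

/-- The girth of `H`: the least length of a cycle, and `⊤` if `H` has no cycle. -/
noncomputable def girth {α : Type*} (H : Hypergraph α) : ℕ∞ :=
  ⨅ (m : ℕ) (_ : ∃ (v : ZMod m → α) (e : ZMod m → Set α), H.IsCycle m v e), (m : ℕ∞)

end Hypergraph

/-- `V 0, …, V (n - 1)` is a partition of the set `X` (into nonempty parts). -/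
structure IsVertexPartition {α : Type*} {n : ℕ} (X : Set α) (V : Fin n → Set α) : Prop where
  nonempty : ∀ i, (V i).Nonempty
  disjoint : ∀ i j, i ≠ j → Disjoint (V i) (V j)
  iUnion_eq : ⋃ i, V i = X

/-- An `n`-set `U` that meets each part `V 0, …, V (n - 1)` in exactly one point. -/
def IsTransversal {α : Type*} {n : ℕ} (V : Fin n → Set α) (U : Set α) : Prop :=
  U.ncard = n ∧ ∀ i, (U ∩ V i).ncard = 1

/-- All points of `U` have the same colour. -/
def IsMonochromatic {α : Type*} (χ : α → ℕ) (U : Set α) : Prop :=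
  ∃ c, ∀ x ∈ U, χ x = c

/-- Distinct points of `U` have distinct colours. -/
def IsHeterochromatic {α : Type*} (χ : α → ℕ) (U : Set α) : Prop :=
  Set.InjOn χ U

open Finset

namespace FinsetSystem

variable {α : Type*}

/-- Every cycle of the finite set system `E` has length at least `g`. -/
def GirthAtLeast (E : Finset (Finset α)) (g : ℕ) : Prop :=
  ∀ (m : ℕ) (v : ZMod m → α) (e : ZMod m → Finset α), 2 ≤ m → Function.Injective v →
    Function.Injective e → (∀ i, e i ∈ E) → (∀ i, v i ∈ e i) → (∀ i, v (i + 1) ∈ e i) → g ≤ m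

variable [DecidableEq α]

/-- The members of `E` that contain `x`. -/
def star (E : Finset (Finset α)) (x : α) : Finset (Finset α) := E.filter (x ∈ ·)

/-- The vertices reachable from `x` by a walk of length at most `k` in `E`. -/
def ball (E : Finset (Finset α)) : ℕ → α → Finset α
  | 0, x => {x}
  | k + 1, x => (ball E k x).biUnion fun y => insert y ((star E y).biUnion id)

lemma ball_subset_succ (E : Finset (Finset α)) (k : ℕ) (x : α) :
    ball E k x ⊆ ball E (k + 1) x := fun y hy =>
  mem_biUnion.2 ⟨y, hy, mem_insert_self _ _⟩

lemma ball_mono (E : Finset (Finset α)) (x : α) : Monotone fun k => ball E k x :=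
  monotone_nat_of_le_succ fun k => ball_subset_succ E k x

lemma self_mem_ball (E : Finset (Finset α)) (k : ℕ) (x : α) : x ∈ ball E k x :=
  ball_mono E x (Nat.zero_le k) (mem_singleton_self x)

lemma mem_ball_succ {E : Finset (Finset α)} {k : ℕ} {x y z : α} {e : Finset α}
    (hy : y ∈ ball E k x) (he : e ∈ E) (hye : y ∈ e) (hze : z ∈ e) :
    z ∈ ball E (k + 1) x :=
  mem_biUnion.2 ⟨y, hy, mem_insert_of_mem (mem_biUnion.2 ⟨e, mem_filter.2 ⟨he, hye⟩, hze⟩)⟩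

lemma card_ball_le {E : Finset (Finset α)} {n d : ℕ} (hE : ∀ e ∈ E, #e = n)
    (hd : ∀ x, #(star E x) ≤ d) (k : ℕ) (x : α) : #(ball E k x) ≤ (n * d + 1) ^ k := by
  induction k with
  | zero => simp [ball]
  | succ k ih =>
    have h : ∀ y ∈ ball E k x, #(insert y ((star E y).biUnion id)) ≤ n * d + 1 := by
      intro y _
      refine (card_insert_le _ _).trans (Nat.add_le_add_right ?_ 1)
      calc #((star E y).biUnion id) ≤ #(star E y) * n :=
            card_biUnion_le_card_mul _ _ _ fun e he => (hE e (mem_filter.1 he).1).le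
        _ ≤ n * d := by rw [mul_comm]; exact Nat.mul_le_mul_left n (hd y)
    calc #(ball E (k + 1) x) ≤ #(ball E k x) * (n * d + 1) := card_biUnion_le_card_mul _ _ _ h
      _ ≤ (n * d + 1) ^ (k + 1) := by rw [pow_succ]; exact Nat.mul_le_mul_right _ ih

/-- Adding a set of pairwise far apart vertices creates no short cycle. -/
lemma GirthAtLeast.insert {E : Finset (Finset α)} {g : ℕ} (hE : GirthAtLeast E g)
    {s : Finset α} (hs : ∀ x ∈ s, ∀ y ∈ s, x ≠ y → y ∉ ball E g x) :
    GirthAtLeast (insert s E) g := by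
  intro m v e hm hv he heE hl hr
  by_contra! hmg
  by_cases hnew : ∀ i, e i ≠ s
  · exact absurd (hE m v e hm hv he
      (fun i => (mem_insert.1 (heE i)).resolve_left (hnew i)) hl hr) (by omega)
  push Not at hnew
  obtain ⟨i, hi⟩ := hnew
  have hold : ∀ j, j ≠ i → e j ∈ E := fun j hj =>
    (mem_insert.1 (heE j)).resolve_left fun h => hj (he (h.trans hi.symm))
  have hcast : ∀ k : ℕ, 0 < k → k < m → (k : ZMod m) ≠ 0 := fun k hk hkm h =>
    absurd (Nat.le_of_dvd hk ((ZMod.natCast_eq_zero_iff k m).1 h)) (by omega)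
  have hwalk : ∀ k : ℕ, k + 1 ≤ m → v (i + 1 + k) ∈ ball E k (v (i + 1)) := by
    intro k
    induction k with
    | zero => intro _; simpa using self_mem_ball E 0 (v (i + 1))
    | succ k ih =>
      intro hk
      have h := mem_ball_succ (ih (by omega)) (hold (i + 1 + k) ?_) (hl _) (hr _)
      · simpa [add_assoc] using h
      · intro h
        refine hcast (k + 1) (by omega) (by omega) ?_
        have : i + ((k + 1 : ℕ) : ZMod m) = i + 0 := by
          push_cast; rw [add_zero]; nth_rewrite 2 [← h]; ring
        exact add_left_cancel this
  have hback := hwalk (m - 1) (by omega)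
  have hm1 : i + 1 + ((m - 1 : ℕ) : ZMod m) = i := by
    rw [Nat.cast_sub (by omega)]; simp
  rw [hm1] at hback
  refine hs (v (i + 1)) (hi ▸ hr i) (v i) (hi ▸ hl i) (fun h => ?_)
    (ball_mono E _ (by omega : m - 1 ≤ g) hback)
  have := hcast 1 one_pos (by omega)
  exact this (by simpa using hv h)

lemma sum_card_star [Fintype α] {E : Finset (Finset α)} {n : ℕ} (hE : ∀ e ∈ E, #e = n) :
    ∑ x, #(star E x) = n * #E := by
  have := sum_card_bipartiteAbove_eq_sum_card_bipartiteBelow (s := (univ : Finset α)) (t := E)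
    (fun x e => x ∈ e)
  calc ∑ x, #(star E x) = ∑ e ∈ E, #(univ.filter (· ∈ e)) := this
    _ = ∑ e ∈ E, n := sum_congr rfl fun e he => by simp [hE e he]
    _ = n * #E := by simp [mul_comm]

lemma card_filter_le_star_mul_le [Fintype α] {E : Finset (Finset α)} {n : ℕ}
    (hE : ∀ e ∈ E, #e = n) (d : ℕ) :
    #(univ.filter fun x => d ≤ #(star E x)) * d ≤ n * #E := by
  rw [← sum_card_star hE]
  calc _ = ∑ x ∈ univ.filter (fun x => d ≤ #(star E x)), d := by simp
    _ ≤ ∑ x ∈ univ.filter (fun x => d ≤ #(star E x)), #(star E x) :=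
      sum_le_sum fun x hx => (mem_filter.1 hx).2
    _ ≤ _ := sum_le_sum_of_subset (filter_subset _ _)

end FinsetSystem

/-- If one coordinate is confined, given the others, to at most `b` values, then at most
`b * |β| ^ (|ι| - 1)` functions remain. -/
lemma card_filter_coordinate_mem_le {ι β : Type*} [Fintype ι] [DecidableEq ι] [Fintype β]
    [DecidableEq β] (k : ι) (T : ({j // j ≠ k} → β) → Finset β) {b : ℕ} (hT : ∀ h, #(T h) ≤ b) :
    #(univ.filter fun f : ι → β => f k ∈ T fun j => f j) ≤
      b * Fintype.card β ^ (Fintype.card ι - 1) := by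
  have := card_le_mul_card_image_of_maps_to
    (s := univ.filter fun f : ι → β => f k ∈ T fun j => f j) (t := univ)
    (f := fun f (j : {j // j ≠ k}) => f j) (fun _ _ => mem_univ _) b ?_
  · simpa [Fintype.card_subtype_compl] using this
  · intro h _
    refine (card_le_card_of_injOn (fun f => f k) ?_ ?_).trans (hT h)
    · intro f hf
      obtain ⟨hmem, rfl⟩ := mem_filter.1 hf
      exact (mem_filter.1 hmem).2
    · intro f hf f' hf' heq
      have h1 := (mem_filter.1 hf).2
      have h2 := (mem_filter.1 hf').2
      funext j
      by_cases hj : j = k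
      · subst hj; exact heq
      · exact congrFun (h1.trans h2.symm) ⟨j, hj⟩

lemma exists_card_le_mul_card_filter_mem {ι τ : Type*} [Fintype τ] [DecidableEq τ]
    {X : Finset ι} (hX : X.Nonempty) (G : ι → Finset τ) (F : Finset τ) {C W : ℕ} (hW : 0 < W)
    (hG : ∀ i ∈ X, W ≤ #(G i)) (hF : 2 * #F ≤ W) (hτ : Fintype.card τ ≤ C * W) :
    ∃ f, f ∉ F ∧ #X ≤ 2 * C * #(X.filter fun i => f ∈ G i) := by
  have hGF : ∀ i ∈ X, W ≤ 2 * #(G i \ F) := fun i hi => by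
    have := le_card_sdiff F (G i); have := hG i hi; omega
  have hne : (univ \ F).Nonempty := by
    obtain ⟨i, hi⟩ := hX
    have := hGF i hi
    obtain ⟨f, hf⟩ := card_pos.1 (show 0 < #(G i \ F) by omega)
    exact ⟨f, by simpa using (mem_sdiff.1 hf).2⟩
  have hdc := sum_card_bipartiteAbove_eq_sum_card_bipartiteBelow (s := X) (t := univ \ F)
    (fun i f => f ∈ G i)
  have habove : ∀ i, bipartiteAbove (fun i f => f ∈ G i) (univ \ F) i = G i \ F := fun i => by
    ext f; simp [bipartiteAbove, and_comm]
  simp only [habove, bipartiteBelow] at hdc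
  obtain ⟨f, hf, h⟩ := exists_le_of_sum_le (f := fun _ => #X)
    (g := fun f => 2 * C * #(X.filter fun i => f ∈ G i)) hne (by
      calc ∑ f ∈ univ \ F, #X = #(univ \ F) * #X := by simp
        _ ≤ C * W * #X := Nat.mul_le_mul_right _ ((card_le_univ _).trans hτ)
        _ = C * ∑ i ∈ X, W := by simp; ring
        _ ≤ C * ∑ i ∈ X, 2 * #(G i \ F) := Nat.mul_le_mul_left _ (sum_le_sum hGF)
        _ = _ := by rw [← mul_sum, hdc, ← mul_sum]; ring)
  exact ⟨f, (mem_sdiff.1 hf).2, h⟩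

namespace FinsetSystem

variable {α : Type*} [DecidableEq α]

/-- The tuples that must not be turned into a member of `E`, because two of their entries are
close in `E` or because one of their entries already has degree at least `d`. -/
def forbidden [Fintype α] (E : Finset (Finset α)) (n g d : ℕ) : Finset (Fin n → α) :=
  univ.filter fun f => (∃ j k, k ≠ j ∧ f j ∈ ball E g (f k)) ∨ ∃ j, d ≤ #(star E (f j))

lemma card_forbidden_le [Fintype α] {E : Finset (Finset α)} {n d : ℕ} (hE : ∀ e ∈ E, #e = n)
    (hd : ∀ x, #(star E x) ≤ d) (g : ℕ) :
    #(forbidden E n g d) ≤ (n * n * (n * d + 1) ^ g +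
      n * #(univ.filter fun x => d ≤ #(star E x))) * Fintype.card α ^ (n - 1) := by
  set A := Fintype.card α
  set S := univ.filter fun x => d ≤ #(star E x)
  let P : Fin n × Fin n → Finset (Fin n → α) := fun p =>
    univ.filter fun f => p.2 ≠ p.1 ∧ f p.1 ∈ ball E g (f p.2)
  let Q : Fin n → Finset (Fin n → α) := fun j => univ.filter fun f => f j ∈ S
  have hsub : forbidden E n g d ⊆ univ.biUnion P ∪ univ.biUnion Q := by
    intro f hf
    rcases (mem_filter.1 hf).2 with ⟨j, k, h⟩ | ⟨j, h⟩
    · exact mem_union_left _ (mem_biUnion.2 ⟨(j, k), mem_univ _, mem_filter.2 ⟨mem_univ _, h⟩⟩)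
    · exact mem_union_right _ (mem_biUnion.2 ⟨j, mem_univ _, by simpa [Q, S] using h⟩)
  have hP : ∀ p ∈ (univ : Finset (Fin n × Fin n)),
      #(P p) ≤ (n * d + 1) ^ g * A ^ (n - 1) := by
    rintro ⟨j, k⟩ -
    by_cases hjk : k = j
    · simp [P, hjk]
    · simpa [P, hjk] using card_filter_coordinate_mem_le j
        (fun h : {i // i ≠ j} → α => ball E g (h ⟨k, hjk⟩))
        (fun h => card_ball_le hE hd g _)
  have hQ : ∀ j ∈ (univ : Finset (Fin n)), #(Q j) ≤ #S * A ^ (n - 1) := by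
    intro j _
    simpa [Q] using card_filter_coordinate_mem_le j
        (fun _ : {i // i ≠ j} → α => S) (fun _ => le_rfl)
  calc #(forbidden E n g d) ≤ #(univ.biUnion P) + #(univ.biUnion Q) :=
        (card_le_card hsub).trans (card_union_le _ _)
    _ ≤ n * n * ((n * d + 1) ^ g * A ^ (n - 1)) + n * (#S * A ^ (n - 1)) := by
        have h1 := card_biUnion_le_card_mul _ _ _ hP
        have h2 := card_biUnion_le_card_mul _ _ _ hQ
        simp only [card_univ, Fintype.card_prod, Fintype.card_fin] at h1 h2
        exact Nat.add_le_add h1 h2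
    _ = _ := by ring

/-- Greedy choice of a sparse `n`-uniform system: if each `G i` contains a positive proportion of
all `n`-tuples, then there is a system without short cycles that contains, for every `i`, the
range of an injective tuple from `G i`. -/
theorem exists_girthAtLeast_forall_image_mem [Fintype α] {ι : Type*} [Fintype ι]
    {n g d M C W : ℕ} (G : ι → Finset (Fin n → α)) (hW : 0 < W) (hG : ∀ i, W ≤ #(G i))
    (hA : Fintype.card α ^ n ≤ C * W)
    (hforb : ∀ S, S * d ≤ n * M →
      2 * ((n * n * (n * d + 1) ^ g + n * S) * Fintype.card α ^ (n - 1)) ≤ W)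
    (hcount : (2 * C - 1) ^ M * Fintype.card ι < (2 * C) ^ M) :
    ∃ E : Finset (Finset α), (∀ e ∈ E, #e = n) ∧ GirthAtLeast E g ∧
      ∀ i, ∃ f ∈ G i, Function.Injective f ∧ univ.image f ∈ E := by
  classical
  let miss : Finset (Finset α) → Finset ι := fun E =>
    univ.filter fun i => ¬ ∃ f ∈ G i, Function.Injective f ∧ univ.image f ∈ E
  have key : ∀ t ≤ M, ∃ E : Finset (Finset α), (∀ e ∈ E, #e = n) ∧ GirthAtLeast E g ∧
      (∀ x, #(star E x) ≤ d) ∧ #E ≤ t ∧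
      (2 * C) ^ t * #(miss E) ≤ (2 * C - 1) ^ t * Fintype.card ι := by
    intro t
    induction t with
    | zero =>
      refine fun _ => ⟨∅, by simp, fun m v e _ _ _ h => ?_, by simp [star], by simp, ?_⟩
      · exact absurd (h 0) (notMem_empty _)
      · simpa using card_le_univ (miss ∅)
    | succ t ih =>
      intro ht
      obtain ⟨E, hE, hg, hd, hcard, hmiss⟩ := ih (by omega)
      rcases (miss E).eq_empty_or_nonempty with h0 | hne
      · exact ⟨E, hE, hg, hd, by omega, by simp [h0]⟩
      have hF : 2 * #(forbidden E n g d) ≤ W := by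
        refine (Nat.mul_le_mul_left 2 (card_forbidden_le hE hd g)).trans (hforb _ ?_)
        exact (card_filter_le_star_mul_le hE d).trans (Nat.mul_le_mul_left n (by omega))
      obtain ⟨f, hf, hhit⟩ := exists_card_le_mul_card_filter_mem hne G (forbidden E n g d) hW
        (fun i _ => hG i) hF (by simpa using hA)
      have hfar : ∀ j k, k ≠ j → f j ∉ ball E g (f k) := fun j k hjk h =>
        hf (mem_filter.2 ⟨mem_univ _, Or.inl ⟨j, k, hjk, h⟩⟩)
      have hdeg : ∀ j, #(star E (f j)) < d := fun j => by
        by_contra! h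
        exact hf (mem_filter.2 ⟨mem_univ _, Or.inr ⟨j, h⟩⟩)
      have hinj : Function.Injective f := fun j k hjk => by
        by_contra hne
        exact hfar k j hne (hjk ▸ self_mem_ball E g _)
      refine ⟨insert (univ.image f) E, ?_, hg.insert ?_, ?_, ?_, ?_⟩
      · intro e he
        rcases mem_insert.1 he with rfl | he
        · simp [card_image_of_injective _ hinj]
        · exact hE e he
      · simp only [mem_image, mem_univ, true_and, forall_exists_index, forall_apply_eq_imp_iff]
        exact fun k j hkj => hfar j k (fun h => hkj (h ▸ rfl))
      · intro x
        by_cases hx : x ∈ univ.image f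
        · obtain ⟨j, -, rfl⟩ := mem_image.1 hx
          unfold star at hdeg ⊢
          rw [filter_insert, if_pos hx]
          exact (card_insert_le _ _).trans (hdeg j)
        · unfold star at hd ⊢
          rw [filter_insert, if_neg hx]
          exact hd x
      · exact (card_insert_le _ _).trans (by omega)
      · have hsub : miss (insert (univ.image f) E) ⊆ (miss E).filter fun i => f ∉ G i := by
          intro i hi
          have hi := (mem_filter.1 hi).2
          refine mem_filter.2 ⟨mem_filter.2 ⟨mem_univ _, ?_⟩, fun hfi => ?_⟩
          · rintro ⟨f', h1, h2, h3⟩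
            exact hi ⟨f', h1, h2, mem_insert_of_mem h3⟩
          · exact hi ⟨f, hfi, hinj, mem_insert_self _ _⟩
        have hsplit := card_filter_add_card_filter_not (s := miss E) (fun i => f ∈ G i)
        have hle := card_le_card hsub
        have hstep : 2 * C * #(miss (insert (univ.image f) E)) ≤ (2 * C - 1) * #(miss E) := by
          rw [Nat.sub_mul, one_mul]
          have := Nat.mul_le_mul_left (2 * C) hle
          have : 2 * C * #(miss E) = 2 * C * #((miss E).filter fun i => f ∈ G i) +
            2 * C * #((miss E).filter fun i => f ∉ G i) := by rw [← mul_add, hsplit]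
          omega
        calc (2 * C) ^ (t + 1) * #(miss (insert (univ.image f) E))
            = (2 * C) ^ t * (2 * C * #(miss (insert (univ.image f) E))) := by ring
          _ ≤ (2 * C) ^ t * ((2 * C - 1) * #(miss E)) := Nat.mul_le_mul_left _ hstep
          _ = (2 * C - 1) * ((2 * C) ^ t * #(miss E)) := by ring
          _ ≤ (2 * C - 1) * ((2 * C - 1) ^ t * Fintype.card ι) := Nat.mul_le_mul_left _ hmiss
          _ = _ := by ring
  obtain ⟨E, hE, hg, -, -, hmiss⟩ := key M le_rfl
  refine ⟨E, hE, hg, fun i => ?_⟩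
  by_contra hi
  have hpos : 1 ≤ #(miss E) := card_pos.2 ⟨i, mem_filter.2 ⟨mem_univ _, hi⟩⟩
  have := Nat.mul_le_mul_left ((2 * C) ^ M) hpos
  omega

end FinsetSystem

/-- Given `s` colourings of `Fin n × Fin N`, the `n`-tuples that are monochromatic inside one of
the parts `{i} × Fin N`, or transversal and heterochromatic in all colourings. -/
noncomputable def goodTuples {n s N : ℕ} {κ : Type*} (c : Fin s → Fin n × Fin N → κ) :
    Finset (Fin n → Fin n × Fin N) := by
  classical
  exact univ.filter fun f => (∃ r i a, ∀ j, (f j).1 = i ∧ c r (f j) = a) ∨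
    ((∀ j, (f j).1 = j) ∧ ∀ r, Function.Injective fun j => c r (f j))

lemma mem_goodTuples {n s N : ℕ} {κ : Type*} {c : Fin s → Fin n × Fin N → κ}
    {f : Fin n → Fin n × Fin N} : f ∈ goodTuples c ↔
      (∃ r i a, ∀ j, (f j).1 = i ∧ c r (f j) = a) ∨
        ((∀ j, (f j).1 = j) ∧ ∀ r, Function.Injective fun j => c r (f j)) := by
  simp [goodTuples]

lemma pow_le_card_goodTuples {n s L N : ℕ} {κ : Type*} (hn : 1 ≤ n) (hs : 1 ≤ s)
    (hN : N = 2 * s * n ^ 2 * L) (c : Fin s → Fin n × Fin N → κ) : L ^ n ≤ #(goodTuples c) := by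
  classical
  by_cases hlarge : ∃ r i a, L ≤ #(univ.filter fun y : Fin N => c r (i, y) = a)
  · obtain ⟨r, i, a, hL⟩ := hlarge
    calc L ^ n ≤ #(univ.filter fun y : Fin N => c r (i, y) = a) ^ n := Nat.pow_le_pow_left hL n
      _ = #(Fintype.piFinset fun _ : Fin n => univ.filter fun y : Fin N => c r (i, y) = a) := by
        simp
      _ ≤ #(goodTuples c) := by
        refine card_le_card_of_injOn (fun h j => (i, h j)) ?_ ?_
        · intro h hh
          refine mem_goodTuples.2 (Or.inl ⟨r, i, a, fun j => ⟨rfl, ?_⟩⟩)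
          exact (mem_filter.1 (Fintype.mem_piFinset.1 hh j)).2
        · intro h _ h' _ heq
          funext j
          exact congrArg Prod.snd (congrFun heq j)
  push Not at hlarge
  let B : Fin s × Fin n × Fin n → Finset (Fin n → Fin N) := fun p => univ.filter fun h =>
    p.2.2 ≠ p.2.1 ∧ c p.1 (p.2.1, h p.2.1) = c p.1 (p.2.2, h p.2.2)
  have hB : ∀ p ∈ (univ : Finset (Fin s × Fin n × Fin n)), #(B p) ≤ L * N ^ (n - 1) := by
    rintro ⟨r, j, k⟩ -
    by_cases hjk : k = j
    · simp [B, hjk]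
    · simpa [B, hjk] using card_filter_coordinate_mem_le j
        (fun h : {i // i ≠ j} → Fin N =>
          univ.filter fun y : Fin N => c r (j, y) = c r (k, h ⟨k, hjk⟩))
        (fun h => (hlarge r j _).le)
  have hbad : #(univ.biUnion B) ≤ s * (n * n) * (L * N ^ (n - 1)) := by
    simpa using card_biUnion_le_card_mul _ _ _ hB
  have hgood : #(univ \ univ.biUnion B) ≤ #(goodTuples c) := by
    refine card_le_card_of_injOn (fun h j => (j, h j)) ?_ ?_
    · intro h hh
      refine mem_goodTuples.2 (Or.inr ⟨fun _ => rfl, fun r j k hjk => ?_⟩)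
      by_contra hne
      exact (mem_sdiff.1 hh).2 (mem_biUnion.2 ⟨(r, j, k), mem_univ _,
        mem_filter.2 ⟨mem_univ _, Ne.symm hne, hjk⟩⟩)
    · intro h _ h' _ heq
      funext j
      exact congrArg Prod.snd (congrFun heq j)
  have hcompl : #(univ \ univ.biUnion B) + #(univ.biUnion B) = N ^ n := by
    rw [card_sdiff_add_card_eq_card (subset_univ _)]; simp
  have hNn : N ^ n = N * N ^ (n - 1) := by
    rw [← pow_succ', Nat.sub_add_cancel hn]
  have hhalf : 2 * (s * (n * n) * (L * N ^ (n - 1))) = N ^ n := by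
    rw [hNn]; nth_rewrite 2 [hN]; ring
  have h2L : 2 * L ≤ N := by
    rw [hN]
    refine Nat.mul_le_mul_right L ?_
    have : 0 < s * n ^ 2 := by positivity
    nlinarith
  have hLN : 2 * L ^ n ≤ N ^ n := by
    calc 2 * L ^ n ≤ 2 ^ n * L ^ n := Nat.mul_le_mul_right _ (Nat.le_self_pow (by omega) 2)
      _ = (2 * L) ^ n := (mul_pow _ _ _).symm
      _ ≤ N ^ n := Nat.pow_le_pow_left h2L n
  omega

/-- Exponential growth beats a power of a polynomial. -/
lemma exists_pow_mul_polynomial_pow_lt (b K a g k : ℕ) (hb : 1 ≤ b) :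
    ∃ x : ℕ, 1 ≤ x ∧ (b - 1) ^ x * (K * (a * x + 1) ^ g) ^ k < b ^ x := by
  have hb0 : (0 : ℝ) < b := by exact_mod_cast hb
  have hr : |((b - 1 : ℕ) : ℝ) / b| < 1 := by
    rw [abs_of_nonneg (by positivity), div_lt_one hb0]
    exact_mod_cast Nat.sub_lt hb one_pos
  have ht := (tendsto_pow_const_mul_const_pow_of_abs_lt_one (g * k) hr).const_mul
    ((((K * (a + 1) ^ g) ^ k : ℕ)) : ℝ)
  rw [mul_zero] at ht
  obtain ⟨x, hx, hx1⟩ := ((ht.eventually_lt_const one_pos).and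
    (Filter.eventually_ge_atTop 1)).exists
  refine ⟨x, hx1, ?_⟩
  have hle : (K * (a * x + 1) ^ g) ^ k ≤ (K * (a + 1) ^ g) ^ k * x ^ (g * k) := by
    rw [pow_mul, ← mul_pow, mul_assoc, ← mul_pow]
    gcongr
    nlinarith
  refine (Nat.mul_le_mul_left _ hle).trans_lt ?_
  rw [div_pow, ← mul_div_assoc, ← mul_div_assoc, div_lt_one (by positivity)] at hx
  have hx' : (K * (a + 1) ^ g) ^ k * (x ^ (g * k) * (b - 1) ^ x) < b ^ x := by exact_mod_cast hx
  calc _ = (K * (a + 1) ^ g) ^ k * (x ^ (g * k) * (b - 1) ^ x) := by ring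
    _ < _ := hx'

lemma exists_sparse_system_meeting_goodTuples (n s g : ℕ) (hn : 1 ≤ n) (hs : 1 ≤ s) :
    ∃ N, 0 < N ∧ ∃ E : Finset (Finset (Fin n × Fin N)), (∀ e ∈ E, #e = n) ∧
      FinsetSystem.GirthAtLeast E g ∧ ∀ c : Fin s → Fin n × Fin N → Fin n × Fin N,
        ∃ f ∈ goodTuples c, Function.Injective f ∧ univ.image f ∈ E := by
  obtain ⟨D, hD⟩ : ∃ D, D = 2 * s * n ^ 2 := ⟨_, rfl⟩
  have hD0 : 0 < D := by rw [hD]; positivity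
  obtain ⟨Q, hQ⟩ : ∃ Q, Q = 4 * n ^ 2 * (n * D) ^ (n - 1) := ⟨_, rfl⟩
  have hQ0 : 0 < Q := by rw [hQ]; positivity
  obtain ⟨C, hC⟩ : ∃ C, C = (n * D) ^ n := ⟨_, rfl⟩
  have hC0 : 0 < C := by rw [hC]; positivity
  obtain ⟨x, hx1, hx⟩ := exists_pow_mul_polynomial_pow_lt (2 * C) (n * D * Q) (n * Q) g
    (n * D * s) (by omega)
  obtain ⟨d, hd⟩ : ∃ d, d = Q * x := ⟨_, rfl⟩
  have hd0 : 0 < d := by rw [hd]; positivity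
  obtain ⟨L, hL⟩ : ∃ L, L = Q * (n * d + 1) ^ g := ⟨_, rfl⟩
  have hL0 : 0 < L := by rw [hL]; positivity
  subst hD
  refine ⟨2 * s * n ^ 2 * L, by positivity, ?_⟩
  refine FinsetSystem.exists_girthAtLeast_forall_image_mem (d := d) (M := L * x) (C := C)
    (W := L ^ n) goodTuples (by positivity) (pow_le_card_goodTuples hn hs rfl) ?_ ?_ ?_
  · simp only [Fintype.card_prod, Fintype.card_fin]
    rw [hC, ← mul_pow, mul_assoc n]
  · intro S hS
    simp only [Fintype.card_prod, Fintype.card_fin]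
    have h1 : 4 * (n * S) * (n * (2 * s * n ^ 2)) ^ (n - 1) ≤ L := by
      refine Nat.le_of_mul_le_mul_right ?_ hd0
      calc 4 * (n * S) * (n * (2 * s * n ^ 2)) ^ (n - 1) * d
          = 4 * n * (n * (2 * s * n ^ 2)) ^ (n - 1) * (S * d) := by ring
        _ ≤ 4 * n * (n * (2 * s * n ^ 2)) ^ (n - 1) * (n * (L * x)) := Nat.mul_le_mul_left _ hS
        _ = L * d := by rw [hd, hQ]; ring
    have h2 : 4 * (n * n * (n * d + 1) ^ g) * (n * (2 * s * n ^ 2)) ^ (n - 1) = L := by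
      rw [hL, hQ]; ring
    have h3 : 2 * ((n * n * (n * d + 1) ^ g + n * S) * (n * (2 * s * n ^ 2)) ^ (n - 1)) ≤ L := by
      nlinarith
    calc 2 * ((n * n * (n * d + 1) ^ g + n * S) * (n * (2 * s * n ^ 2 * L)) ^ (n - 1))
        = 2 * ((n * n * (n * d + 1) ^ g + n * S) * (n * (2 * s * n ^ 2)) ^ (n - 1)) *
            L ^ (n - 1) := by rw [← mul_assoc n, mul_pow _ L]; ring
      _ ≤ L * L ^ (n - 1) := Nat.mul_le_mul_right _ h3
      _ = L ^ n := by rw [← pow_succ', Nat.sub_add_cancel hn]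
  · simp only [Fintype.card_pi, Fintype.card_prod, Fintype.card_fin, prod_const, card_univ]
    have h := Nat.pow_lt_pow_left hx hL0.ne'
    convert h using 1
    · have : n * (2 * s * n ^ 2) * Q * (n * Q * x + 1) ^ g = n * (2 * s * n ^ 2 * L) := by
        rw [hL, hd]; ring
      rw [this, mul_pow (_ ^ x), ← pow_mul, ← pow_mul, ← pow_mul, mul_comm x L]
      congr 2
      ring
    · rw [← pow_mul, mul_comm x L]

theorem propositionp (n s g : ℕ) (hn : 2 ≤ n) (hg : 2 ≤ g) (hs : 1 ≤ s) :
    ∃ (α : Type) (_ : Finite α) (H : Hypergraph α) (V : Fin n → Set α),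
      H.vertexSet = Set.univ ∧ H.IsUniform n ∧ (g : ℕ∞) ≤ H.girth ∧
      IsVertexPartition H.vertexSet V ∧
      ∀ χ : Fin s → α → ℕ,
        (∃ r : Fin s, ∃ i : Fin n, ∃ e ∈ H.edgeSet, e ⊆ V i ∧ IsMonochromatic (χ r) e) ∨
        (∃ e ∈ H.edgeSet, IsTransversal V e ∧ ∀ r : Fin s, IsHeterochromatic (χ r) e) := by
  obtain ⟨N, hN, E, hE, hgirth, hmeet⟩ :=
    exists_sparse_system_meeting_goodTuples n s g (by omega) hs
  have : NeZero N := ⟨hN.ne'⟩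
  have : NeZero n := ⟨by omega⟩
  refine ⟨Fin n × Fin N, inferInstance,
    ⟨Set.univ, (fun e : Finset (Fin n × Fin N) => (e : Set (Fin n × Fin N)))
      '' (E : Set _), fun _ _ => Set.subset_univ _⟩,
    fun i => {p | p.1 = i}, rfl, ?_, ?_, ?_, ?_⟩
  · rintro _ ⟨e, he, rfl⟩
    simpa [Set.ncard_coe_finset] using hE e he
  · refine le_iInf₂ fun m hm => ?_
    obtain ⟨v, e, hc⟩ := hm
    choose e' he' heq using hc.edge_mem
    simp only at heq
    refine Nat.cast_le.2 (hgirth m v e' hc.two_le hc.vertex_injective (fun i j hij => ?_) he'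
      (fun i => ?_) fun i => ?_)
    · exact hc.edge_injective (by rw [← heq i, ← heq j, hij])
    · have := hc.left_mem i
      rwa [← heq i] at this
    · have := hc.right_mem i
      rwa [← heq i] at this
  · refine ⟨fun i => ⟨(i, 0), rfl⟩, fun i j hij => ?_, ?_⟩
    · exact Set.disjoint_left.2 fun p hi hj => hij (hi.symm.trans hj)
    · ext p; simp
  · intro χ
    have hinv : ∀ r x, χ r (Function.invFun (χ r) (χ r x)) = χ r x := fun r x =>
      Function.invFun_eq ⟨x, rfl⟩
    have hker : ∀ r x y, Function.invFun (χ r) (χ r x) = Function.invFun (χ r) (χ r y) →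
        χ r x = χ r y := fun r x y h => by
      have := congrArg (χ r) h
      rwa [hinv, hinv] at this
    obtain ⟨f, hf, hinj, hfE⟩ := hmeet fun r x => Function.invFun (χ r) (χ r x)
    have hmem : Set.range f ∈ (fun e : Finset (Fin n × Fin N) => (e : Set (Fin n × Fin N)))
        '' (E : Set _) :=
      ⟨_, hfE, by simp⟩
    rcases mem_goodTuples.1 hf with ⟨r, i, a, h⟩ | ⟨htr, hhet⟩
    · refine Or.inl ⟨r, i, _, hmem, ?_, χ r (f 0), ?_⟩
      · rintro _ ⟨j, rfl⟩
        exact (h j).1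
      · rintro _ ⟨j, rfl⟩
        exact hker r _ _ ((h j).2.trans (h 0).2.symm)
    · refine Or.inr ⟨_, hmem, ⟨?_, fun i => ?_⟩, fun r => ?_⟩
      · rw [← Set.image_univ, Set.ncard_image_of_injective _ hinj]; simp
      · rw [Set.ncard_eq_one]
        refine ⟨f i, Set.eq_singleton_iff_unique_mem.2 ⟨⟨⟨i, rfl⟩, htr i⟩, ?_⟩⟩
        rintro _ ⟨⟨j, rfl⟩, hj⟩
        rw [← (htr j).symm.trans hj]
      · rintro _ ⟨j, rfl⟩ _ ⟨k, rfl⟩ hjk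
        exact congrArg f (hhet r (congrArg (Function.invFun (χ r)) hjk))
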